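/- Let $q$ be a prime power, $A=\mathbb{F}_q[\theta]$, $A_+\subset A$ the set of monic polynomials, $K=\mathbb{F}_q(\theta)$ with the absolute value determined by $|a|=q^{\deg_\theta a}$ for $0\neq a\in A$, $K_\infty$ the completion of $K$ for this absolute value, and $\mathbb{C}_\infty$ the completion of an algebraic closure of $K_\infty$. For $z\in\mathbb{C}_\infty$ put $|z|_i=\inf_{x\in K_\infty}|z-x|$, and let $\Omega_1=\{z\in\mathbb{C}_\infty\setminus K_\infty : |z|_i>1\}$. For $t\in\mathbb{C}_\infty$ and $c\in A$ let $\chi_t(c)=c(t)$ be the value of the polynomial $c$ at $\theta=t$. Let $1\le l\le q$. Then for all $z\in\Omega_1$ and all $t\in\mathbb{C}_\infty$ with $|t|<q^q$, the iterated series $$\sum_{c\in A_+}\Bigl(\sum_{d\in A}\frac{\chi_t(c)^l}{(cz+d)^l}\Bigr)\quad\text{and}\quad \sum_{c\in A_+}\Bigl(\sum_{d\in A}\frac{\chi_t(c)}{cz+d}\Bigr)$$ converge in $\mathbb{C}_\infty$ (each inner series over $d$ converges for every $c\in A_+$, and so does the outer series of the inner sums; convergence is unconditional), and $$\sum_{c\in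 A_+}\sum_{d\in A}\frac{\chi_t(c)^l}{(cz+d)^l}=\Bigl(\sum_{c\in A_+}\sum_{d\in A}\frac{\chi_t(c)}{cz+d}\Bigr)^l .$$ -/

import Mathlib

open scoped NNReal WithZero Polynomial

noncomputable section

namespace DrinfeldUpper

variable (F : Type*) [Field F]

open Classical in
/-- `K_∞`: the completion of `K = F(θ)` at the place at infinity (the indeterminate `θ` of
`A = F[θ]` is `Polynomial.X`). -/
abbrev Kinfty : Type _ := RatFunc.CompletionAtInfty F

/-- The embedding `K → K_∞`. -/
def ratEmb : RatFunc F →+* Kinfty F := algebraMap (RatFunc F) (Kinfty F)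

theorem valued_ratEmb (x : RatFunc F) :
    Valued.v (ratEmb F x) = @RatFunc.inftyValuationDef F _ (Classical.decEq _) x := by
  classical
  exact @Valued.extensionValuation_apply_coe (RatFunc F) _ ℤᵐ⁰ _
    (@RatFunc.inftyValued F _ (Classical.decEq _)) x

instance completeSpace_Kinfty : CompleteSpace (Kinfty F) := by
  classical
  exact @UniformSpace.Completion.completeSpace (RatFunc F)
    (@RatFunc.inftyValued F _ (Classical.decEq _)).toUniformSpace

variable [Finite F]

theorem one_lt_card : (1 : ℝ≥0) < (Nat.card F : ℝ≥0) := by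
  exact_mod_cast Finite.one_lt_card (α := F)

/-- The valuation at infinity, made real valued in base `q = #F`, so that `|a| = q ^ deg a`
for `0 ≠ a ∈ A`. -/
instance rankOne_Kinfty : Valuation.RankOne (Valued.v : Valuation (Kinfty F) ℤᵐ⁰) where
  hom' := (WithZeroMulInt.toNNReal (one_lt_card F).ne_zero).comp
    MonoidWithZeroHom.ValueGroup₀.embedding
  strictMono' := (WithZeroMulInt.toNNReal_strictMono (one_lt_card F)).comp
    MonoidWithZeroHom.ValueGroup₀.embedding_strictMono
  exists_val_nontrivial := by
    refine ⟨ratEmb F RatFunc.X, ?_⟩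
    rw [valued_ratEmb,
      @RatFunc.inftyValuation_of_nonzero F _ (Classical.decEq _) _ RatFunc.X_ne_zero,
      RatFunc.intDegree_X]
    refine ⟨WithZero.exp_ne_zero, ?_⟩
    rw [Ne, WithZero.exp_eq_one]
    exact one_ne_zero

instance normedField_Kinfty : NontriviallyNormedField (Kinfty F) :=
  Valued.toNontriviallyNormedField (Kinfty F) ℤᵐ⁰

instance isUltrametricDist_Kinfty : IsUltrametricDist (Kinfty F) :=
  IsUltrametricDist.isUltrametricDist_of_forall_norm_add_le_max_norm
    (Valued.isNonarchimedean_norm (Kinfty F) ℤᵐ⁰)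

theorem norm_Kinfty_def (x : Kinfty F) :
    ‖x‖ = WithZeroMulInt.toNNReal (one_lt_card F).ne_zero (Valued.v x) := by
  change ((WithZeroMulInt.toNNReal (one_lt_card F).ne_zero
    (MonoidWithZeroHom.ValueGroup₀.embedding ((Valued.v : Valuation (Kinfty F) ℤᵐ⁰).restrict x)) :
      ℝ≥0) : ℝ) = _
  rw [Valuation.embedding_restrict]

/-- A fixed algebraic closure of `K_∞`, with the unique extension of the absolute value. -/
abbrev KinftyBar : Type _ := AlgebraicClosure (Kinfty F)

instance normedField_KinftyBar : NormedField (KinftyBar F) :=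
  spectralNorm.normedField (Kinfty F) (KinftyBar F)

instance normedAlgebra_KinftyBar : NormedAlgebra (Kinfty F) (KinftyBar F) :=
  spectralNorm.normedAlgebra (Kinfty F) (KinftyBar F)

/-- `ℂ_∞`: the completion of the algebraic closure of `K_∞`. -/
abbrev Cinfty : Type _ := UniformSpace.Completion (KinftyBar F)

/-- The embedding `K_∞ → ℂ_∞`. -/
def embK : Kinfty F →+* Cinfty F :=
  (UniformSpace.Completion.coeRingHom (α := KinftyBar F)).comp
    (algebraMap (Kinfty F) (KinftyBar F))

/-- The embedding `A = F[θ] → ℂ_∞`. -/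
def embA : F[X] →+* Cinfty F :=
  ((embK F).comp (ratEmb F)).comp (algebraMap F[X] (RatFunc F))

theorem norm_embK (x : Kinfty F) : ‖embK F x‖ = ‖x‖ := by
  change ‖((algebraMap (Kinfty F) (KinftyBar F) x : KinftyBar F) : Cinfty F)‖ = ‖x‖
  rw [UniformSpace.Completion.norm_coe, norm_algebraMap']

theorem norm_embA {a : F[X]} (ha : a ≠ 0) :
    ‖embA F a‖ = (Nat.card F : ℝ) ^ a.natDegree := by
  change ‖embK F (ratEmb F (algebraMap F[X] (RatFunc F) a))‖ = _
  rw [norm_embK, norm_Kinfty_def, valued_ratEmb,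
    @RatFunc.inftyValuation.polynomial F _ (Classical.decEq _) _ ha]
  rw [WithZeroMulInt.toNNReal_neg_apply _ WithZero.exp_ne_zero]
  change (((Nat.card F : ℝ≥0) ^ (a.natDegree : ℤ) : ℝ≥0) : ℝ) = _
  simp

variable {F}

/-- `χ_t(a) = a(t)`, the value at `t ∈ ℂ_∞` of the polynomial `a ∈ A` with `θ` replaced by `t`. -/
def chi (t : Cinfty F) : F[X] →+* Cinfty F :=
  Polynomial.eval₂RingHom ((embA F).comp Polynomial.C) t

/-- The imaginary distance `|z|_i = inf_{x ∈ K_∞} |z - x|`. -/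
def imDist (z : Cinfty F) : ℝ := ⨅ x : Kinfty F, ‖z - embK F x‖

variable (F)

/-- The Drinfeld upper half-plane `Ω = ℂ_∞ ∖ K_∞`. -/
def Omega : Set (Cinfty F) := (Set.range (embK F))ᶜ

/-- The neighbourhood of infinity `Ω_1 = {z ∈ Ω : |z|_i > 1}`. -/
def Omega1 : Set (Cinfty F) := {z | z ∈ Omega F ∧ 1 < imDist z}

/-- The set `A_+` of monic polynomials. -/
abbrev APlus : Type _ := {c : F[X] // c.Monic}

end DrinfeldUpper

end

open DrinfeldUpper

/-! The core is an identity over a finite `F`-space `V` of dimension `n`, with `q = #F`. If `f : V →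
L` is linear and injective, every linear `g` is `∑ aᵢ f^(q^i)`, `i < n`, so off `0` the ratio `g /
f` is `P(f)` with `P = ∑ aᵢ X^(q^i - 1)`. For `l ≤ q` the degree of `P^l` is below `#V - 1`, so
`P^l` sums to zero over `f(V)`; removing the node `0` leaves `-P(0)^l = -a₀^l`, with `a₀`
independent of `l` (`exists_sum_div_pow_eq`).

Take `f = cz + d` and `g = χ_t(c)` with `c`, `d` of bounded degree, and let the bound on `d` grow
(`sum_pow_mul_latticeSum`). Scaling by `Fˣ` reduces to monic `c`, as `q - 1 = -1` in `L`; then the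
bound on `c` grows.

For convergence, `∑_d 1/(cz + d)` is a limit of products whose size is at most `ρ^(-2^(deg c))` with
`ρ > 1` (`norm_latticeSum_le`), which beats `|χ_t(c)| ≤ max(1, |t|)^(deg c)`. Order `l` reduces to
order one by `latticeSum_eq_pow`. -/

/-! ### Lagrange interpolation at a finite additive group of nodes. -/

section FiniteSums

open Polynomial

variable {V L : Type*} [AddCommGroup V] [Fintype V] [DecidableEq V] [Field L]

/-- The derivative of `∏ v, (X - f v)` takes the same value at all points of a finite additive
group of nodes. -/
theorem prod_erase_sub_eq (f : V →+ L) (i : V) :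
    ∏ j ∈ Finset.univ.erase i, (f i - f j) = ∏ j ∈ Finset.univ.erase 0, f j := by
  refine Finset.prod_bij' (fun j _ => i - j) (fun j _ => i - j) ?_ ?_ ?_ ?_ ?_
  · intro j hj
    simpa [sub_eq_zero, eq_comm] using hj
  · intro j hj
    simpa using hj
  · intro j _
    simp
  · intro j _
    simp
  · intro j _
    simp

/-- Lagrange interpolation writes the vanishing coefficient of degree `#V - 1` as `∑ P(f v) / ∏_{j ≠
v} (f v - f j)`, and these denominators all agree. -/
theorem sum_eval_eq_zero_of_natDegree_lt (f : V →+ L) (hf : Function.Injective f) (P : L[X])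
    (hP : P.natDegree + 1 < Fintype.card V) : ∑ v, P.eval (f v) = 0 := by
  have h := Lagrange.coeff_eq_sum (s := Finset.univ) (v := f) hf.injOn (P := P)
    (lt_of_le_of_lt degree_le_natDegree (by
      rw [Finset.card_univ]; exact_mod_cast (Nat.lt_succ_self _).trans hP))
  rw [coeff_eq_zero_of_natDegree_lt (by rw [Finset.card_univ]; lia)] at h
  simp only [prod_erase_sub_eq, ← Finset.sum_div] at h
  rcases div_eq_zero_iff.mp h.symm with h | h
  · exact h
  · obtain ⟨j, hj, hj0⟩ := Finset.prod_eq_zero_iff.mp h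
    exact absurd (hf (hj0.trans (map_zero f).symm)) (Finset.ne_of_mem_erase hj)

/-- Interpolating the constant `1` gives the partial fractions of `1 / ∏ (X - f v)`; all the nodal
weights coincide. -/
theorem sum_inv_sub_eq_div (f : V →+ L) (hf : Function.Injective f) (w : L) (hw : ∀ v, w ≠ f v) :
    ∑ v, (w - f v)⁻¹ = (∏ v ∈ Finset.univ.erase 0, f v) / ∏ v, (w - f v) := by
  have h := Lagrange.eval_interpolate_not_at_node (s := Finset.univ) (v := f) 1
    (fun i _ => hw i)
  rw [Lagrange.interpolate_one hf.injOn Finset.univ_nonempty] at h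
  simp only [eval_one, Lagrange.eval_nodal, Lagrange.nodalWeight, Finset.prod_inv_distrib,
    prod_erase_sub_eq, Pi.one_apply, mul_one, ← Finset.mul_sum] at h
  have h1 : ∏ v, (w - f v) ≠ 0 :=
    Finset.prod_ne_zero_iff.mpr fun v _ => sub_ne_zero.mpr (hw v)
  have h2 : ∏ v ∈ Finset.univ.erase 0, f v ≠ 0 :=
    Finset.prod_ne_zero_iff.mpr fun v hv h0 =>
      Finset.ne_of_mem_erase hv (hf (h0.trans (map_zero f).symm))
  field_simp at h ⊢
  exact h.symm

end FiniteSums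

/-! ### Linearized polynomials and power sums of ratios of linear forms. -/

section Linearized

open Polynomial

variable {F V L : Type*} [Field F] [Finite F] [Field L] [Algebra F L] [AddCommGroup V] [Module F V]

/-- The linearized polynomial `∑ a i * Y ^ (q ^ i)` composed with an `F`-linear map. -/
noncomputable def linearizedComp (f : V →ₗ[F] L) (n : ℕ) : (Fin n → L) →ₗ[L] (V →ₗ[F] L) :=
  letI := Fintype.ofFinite F
  ∑ i : Fin n, (LinearMap.proj i).smulRight
    (((FiniteField.frobeniusAlgHom F L) ^ (i : ℕ)).toLinearMap ∘ₗ f)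

theorem linearizedComp_apply (f : V →ₗ[F] L) (n : ℕ) (a : Fin n → L) (v : V) :
    linearizedComp f n a v = ∑ i : Fin n, a i * f v ^ Nat.card F ^ (i : ℕ) := by
  simp [linearizedComp, LinearMap.sum_apply, AlgHom.coe_pow, FiniteField.coe_frobeniusAlgHom,
    pow_iterate]
  rw [@Nat.card_eq_fintype_card F (Fintype.ofFinite F)]

/-- A kernel element is a polynomial of degree less than `#V` vanishing at the `#V` points `f v`. -/
theorem linearizedComp_injective [Finite V] (f : V →ₗ[F] L) (hf : Function.Injective f) :
    Function.Injective (linearizedComp f (Module.finrank F V)) := by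
  classical
  have := Fintype.ofFinite V
  have hq : 1 < Nat.card F := Finite.one_lt_card
  rw [← LinearMap.ker_eq_bot, LinearMap.ker_eq_bot']
  intro a ha
  set P : L[X] := ∑ i : Fin (Module.finrank F V), C (a i) * X ^ Nat.card F ^ (i : ℕ) with hP
  have hdeg : P.degree < (Finset.univ : Finset V).card := by
    refine (degree_sum_le _ _).trans_lt ((Finset.sup_lt_iff (WithBot.bot_lt_coe _)).mpr ?_)
    intro i _
    refine (degree_C_mul_X_pow_le _ _).trans_lt ?_
    rw [Finset.card_univ, ← Nat.card_eq_fintype_card, Module.natCard_eq_pow_finrank (K := F) (V := V)]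
    exact_mod_cast Nat.pow_lt_pow_right hq i.2
  have hP0 : P = 0 := by
    refine eq_zero_of_degree_lt_of_eval_index_eq_zero (v := f) _ hf.injOn hdeg fun v _ => ?_
    have := congrArg (fun φ : V →ₗ[F] L => φ v) ha
    simpa [linearizedComp_apply, hP, eval_finsetSum] using this
  ext i
  have h := congrArg (fun Q => Q.coeff (Nat.card F ^ (i : ℕ))) hP0
  simpa [hP, finsetSum_coeff, coeff_X_pow, Nat.pow_right_inj hq, Fin.val_inj] using h

theorem linearizedComp_surjective [Finite V] (f : V →ₗ[F] L) (hf : Function.Injective f) :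
    Function.Surjective (linearizedComp f (Module.finrank F V)) := by
  refine (LinearMap.injective_iff_surjective_of_finrank_eq_finrank ?_).mp
    (linearizedComp_injective f hf)
  rw [Module.finrank_linearMap_self, Module.finrank_fin_fun]

/-- Up to order `q`, the power sums of the ratio of two linear forms on a finite `F`-vector space
are the powers of a single element. -/
theorem exists_sum_div_pow_eq [Fintype V] [DecidableEq V] (f g : V →ₗ[F] L)
    (hf : Function.Injective f) :
    ∃ γ : L, ∀ l : ℕ, 1 ≤ l → l ≤ Nat.card F →
      ∑ v ∈ Finset.univ.erase (0 : V), (g v / f v) ^ l = -γ ^ l := by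
  have hq : 1 < Nat.card F := Finite.one_lt_card
  obtain ⟨a, rfl⟩ := linearizedComp_surjective f hf g
  have hcard : Fintype.card V = Nat.card F ^ Module.finrank F V := by
    rw [← Nat.card_eq_fintype_card, Module.natCard_eq_pow_finrank (K := F)]
  generalize Module.finrank F V = n at a hcard
  cases n with
  | zero =>
    refine ⟨0, fun l hl _ => ?_⟩
    have : Subsingleton V := Fintype.card_le_one_iff_subsingleton.mp (by simp [hcard])
    rw [Finset.sum_eq_zero fun v hv => absurd (Subsingleton.elim v 0) (Finset.ne_of_mem_erase hv),
      zero_pow (by lia), neg_zero]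
  | succ n =>
    refine ⟨a 0, fun l hl hlq => ?_⟩
    set P : L[X] := ∑ i : Fin (n + 1), C (a i) * X ^ (Nat.card F ^ (i : ℕ) - 1) with hP
    have hPdeg : P.natDegree ≤ Nat.card F ^ n - 1 :=
      natDegree_sum_le_of_forall_le _ _ fun i _ => (natDegree_C_mul_X_pow_le _ _).trans
        (Nat.sub_le_sub_right (Nat.pow_le_pow_right hq.le (Nat.lt_succ_iff.mp i.2)) 1)
    -- This is where `l ≤ q` enters: `q (q^n - 1) + 1 < q^(n+1)`, the dimension now being `n + 1`.
    have hdeg : (P ^ l).natDegree + 1 < Fintype.card V := by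
      have h1 : (P ^ l).natDegree ≤ Nat.card F * (Nat.card F ^ n - 1) :=
        natDegree_pow_le.trans (Nat.mul_le_mul hlq hPdeg)
      have h2 : Nat.card F ≤ Nat.card F ^ n * Nat.card F :=
        Nat.le_mul_of_pos_left _ (pow_pos (by lia) n)
      rw [Nat.mul_sub, mul_one, mul_comm] at h1
      rw [hcard, pow_succ]
      lia
    have h0 : P.eval 0 = a 0 := by
      rw [hP, eval_finsetSum, Finset.sum_eq_single 0]
      · simp
      · intro i _ hi
        have : Nat.card F ^ (i : ℕ) - 1 ≠ 0 := by
          have := Nat.one_lt_pow (n := (i : ℕ)) (fun h => hi (Fin.ext h)) hq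
          lia
        simp [this]
      · simp
    have hsum := sum_eval_eq_zero_of_natDegree_lt f.toAddMonoidHom hf (P ^ l) hdeg
    rw [← Finset.add_sum_erase _ _ (Finset.mem_univ (0 : V)), map_zero, eval_pow, h0] at hsum
    rw [eq_neg_iff_add_eq_zero, add_comm, ← hsum]
    congr 1
    refine Finset.sum_congr rfl fun v hv => ?_
    have hv0 : f v ≠ 0 := fun h => Finset.ne_of_mem_erase hv (hf (h.trans (map_zero f).symm))
    rw [eval_pow, linearizedComp_apply, hP, eval_finsetSum, Finset.sum_div]
    congr 1
    refine Finset.sum_congr rfl fun i _ => ?_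
    simp only [eval_mul, eval_C, eval_pow, eval_X, LinearMap.toAddMonoidHom_coe]
    rw [mul_div_assoc, pow_sub₀ _ hv0 (Nat.one_le_pow _ _ (by lia)), pow_one, div_eq_mul_inv]

end Linearized

/-! ### Exhausting `F[X]` by degree, and reduction to monic polynomials. -/

section PolynomialsOfBoundedDegree

open Polynomial Filter Topology

variable (F : Type*) [Field F] [Finite F]

instance finite_degreeLT (n : ℕ) : Finite (degreeLT F n) :=
  Module.finite_of_finite F

/-- The finite set of polynomials of degree less than `n`. -/
noncomputable def polysDegreeLT (n : ℕ) : Finset F[X] :=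
  (show (degreeLT F n : Set F[X]).Finite from finite_degreeLT F n).toFinset

variable {F}

theorem mem_polysDegreeLT {n : ℕ} {p : F[X]} : p ∈ polysDegreeLT F n ↔ p.degree < n := by
  simp [polysDegreeLT, mem_degreeLT]

theorem sum_polysDegreeLT {M : Type*} [AddCommMonoid M] (n : ℕ) [Fintype (degreeLT F n)]
    (h : F[X] → M) : ∑ p ∈ polysDegreeLT F n, h p = ∑ p : degreeLT F n, h p :=
  Finset.sum_subtype _ (fun p => by rw [mem_polysDegreeLT, mem_degreeLT]) h

theorem card_polysDegreeLT (n : ℕ) : (polysDegreeLT F n).card = Nat.card F ^ n := by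
  rw [polysDegreeLT, ← Set.ncard_eq_toFinset_card _ (finite_degreeLT F n)]
  change Nat.card (degreeLT F n) = _
  rw [Nat.card_congr (degreeLTEquiv F n).toEquiv, Nat.card_fun, Nat.card_fin]

theorem polysDegreeLT_mono : Monotone (polysDegreeLT F) := fun m n h p hp =>
  mem_polysDegreeLT.mpr ((mem_polysDegreeLT.mp hp).trans_le (by exact_mod_cast h))

theorem tendsto_polysDegreeLT : Tendsto (polysDegreeLT F) atTop atTop :=
  tendsto_atTop_finset_of_monotone polysDegreeLT_mono fun p =>
    ⟨p.natDegree + 1, mem_polysDegreeLT.mpr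
      (degree_le_natDegree.trans_lt (by exact_mod_cast Nat.lt_succ_self _))⟩

theorem tendsto_natDegree_cofinite : Tendsto (natDegree : F[X] → ℕ) cofinite atTop := by
  refine tendsto_atTop.mpr fun n => ?_
  rw [eventually_cofinite]
  refine (polysDegreeLT F n).finite_toSet.subset fun p hp => ?_
  exact mem_polysDegreeLT.mpr (degree_le_natDegree.trans_lt (by exact_mod_cast not_le.mp hp))

theorem natCast_card_units_eq_neg_one (F L : Type*) [Field F] [Fintype F] [DecidableEq F] [Ring L]
    [Algebra F L] : ((Fintype.card Fˣ : ℕ) : L) = -1 := by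
  rw [Fintype.card_units, Nat.cast_sub Fintype.card_pos, ← map_natCast (algebraMap F L),
    FiniteField.cast_card_eq_zero]
  simp

/-- A sum of values invariant under scaling of the polynomial by `Fˣ` is, up to sign, the sum over
monic polynomials. -/
theorem sum_polysDegreeLT_eq_neg_sum_monic {L : Type*} [Field L] [Algebra F L] (n : ℕ)
    [DecidablePred (Monic : F[X] → Prop)] (h : F[X] → L) (h0 : h 0 = 0)
    (hsmul : ∀ (a : F) (p : F[X]), a ≠ 0 → h (a • p) = h p) :
    ∑ p ∈ polysDegreeLT F n, h p = -∑ p ∈ (polysDegreeLT F n).filter Monic, h p := by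
  classical
  have := Fintype.ofFinite F
  have hprod : ∑ x ∈ (Finset.univ : Finset Fˣ) ×ˢ (polysDegreeLT F n).filter Monic, h x.2 =
      -∑ p ∈ (polysDegreeLT F n).filter Monic, h p := by
    rw [Finset.sum_product]
    dsimp only
    rw [Finset.sum_const, Finset.card_univ, nsmul_eq_mul, natCast_card_units_eq_neg_one F L, neg_one_mul]
  rw [← hprod, ← Finset.sum_filter_of_ne (p := fun p => p ≠ 0)
    (fun p _ hp hp0 => hp (by rw [hp0, h0]))]
  symm
  refine Finset.sum_bij (fun x _ => (x.1 : F) • x.2) ?_ ?_ ?_ ?_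
  · intro x hx
    simp only [Finset.mem_product, Finset.mem_univ, true_and, Finset.mem_filter,
      mem_polysDegreeLT] at hx ⊢
    exact ⟨(degree_smul_le _ _).trans_lt hx.1, smul_ne_zero x.1.ne_zero hx.2.ne_zero⟩
  · rintro ⟨a, p⟩ hx ⟨b, r⟩ hy hxy
    simp only [Finset.mem_product, Finset.mem_univ, true_and, Finset.mem_filter] at hx hy hxy
    have hlead := congrArg leadingCoeff hxy
    rw [smul_eq_C_mul, smul_eq_C_mul, leadingCoeff_mul, leadingCoeff_mul, leadingCoeff_C,
      leadingCoeff_C, hx.2.leadingCoeff, hy.2.leadingCoeff, mul_one, mul_one] at hlead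
    obtain rfl := Units.ext hlead
    rw [smul_right_injective _ a.ne_zero hxy]
  · intro p hp
    simp only [Finset.mem_filter, mem_polysDegreeLT] at hp
    have hl : p.leadingCoeff ≠ 0 := leadingCoeff_ne_zero.mpr hp.2
    refine ⟨(Units.mk0 _ hl, p.leadingCoeff⁻¹ • p), ?_, ?_⟩
    · simp only [Finset.mem_product, Finset.mem_univ, true_and, Finset.mem_filter,
        mem_polysDegreeLT]
      refine ⟨(degree_smul_le _ _).trans_lt hp.1, ?_⟩
      rw [Monic, smul_eq_C_mul, leadingCoeff_mul, leadingCoeff_C, inv_mul_cancel₀ hl]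
    · simp [smul_smul, hl]
  · intro x _
    exact (hsmul _ _ x.1.ne_zero).symm

end PolynomialsOfBoundedDegree

/-! ### Lattice sums and their power identities. -/

section LatticeSums

open Polynomial Filter Topology

variable {F L : Type*} [Field F] [NormedField L] [Algebra F L] (ι : F[X] →ₐ[F] L)

/-- The lattice sum `∑ 1 / (w + d) ^ l` over `d ∈ F[X]`, embedded in `L` by `ι`. -/
noncomputable def latticeSum (l : ℕ) (w : L) : L := ∑' d : F[X], ((w + ι d) ^ l)⁻¹

theorem tsum_div_eq_mul_latticeSum (l : ℕ) (x w : L) :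
    ∑' d : F[X], x / (w + ι d) ^ l = x * latticeSum ι l w := by
  simp only [div_eq_mul_inv, tsum_mul_left, latticeSum]

theorem pow_mul_latticeSum_smul (l : ℕ) (a : F) (ha : a ≠ 0) (w : L) :
    algebraMap F L a ^ l * latticeSum ι l (a • w) = latticeSum ι l w := by
  have ha' : algebraMap F L a ≠ 0 := by simpa using ha
  rw [latticeSum, ← (LinearEquiv.smulOfNeZero F F[X] a ha).toEquiv.tsum_eq, ← tsum_mul_left,
    latticeSum]
  refine tsum_congr fun d => ?_
  have : a • w + ι (a • d) = algebraMap F L a * (w + ι d) := by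
    rw [map_smul, ← smul_add, Algebra.smul_def]
  simp only [LinearEquiv.coe_toEquiv, LinearEquiv.smulOfNeZero_apply, this, mul_pow, mul_inv]
  rw [← mul_assoc, mul_inv_cancel₀ (pow_ne_zero _ ha'), one_mul]

variable [Finite F] {ι} (hι : ∀ a : F[X], a ≠ 0 → ‖ι a‖ = (Nat.card F : ℝ) ^ a.natDegree)
include hι

theorem tendsto_cobounded_of_norm_eq : Tendsto ι cofinite (Bornology.cobounded L) := by
  rw [← tendsto_norm_atTop_iff_cobounded]
  have hq : (1 : ℝ) < Nat.card F := by exact_mod_cast Finite.one_lt_card (α := F)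
  refine ((tendsto_pow_atTop_atTop_of_one_lt hq).comp tendsto_natDegree_cofinite).congr' ?_
  filter_upwards [(Set.finite_singleton (0 : F[X])).compl_mem_cofinite] with a ha
  exact (hι a ha).symm

variable [CompleteSpace L] [IsUltrametricDist L]

theorem summable_inv_add_pow (l : ℕ) (hl : l ≠ 0) (w : L) :
    Summable fun d : F[X] => ((w + ι d) ^ l)⁻¹ := by
  refine NonarchimedeanAddGroup.summable_of_tendsto_cofinite_zero ?_
  have h1 : Tendsto (fun d => w + ι d) cofinite (Bornology.cobounded L) :=
    (tendsto_const_add_cobounded w).comp (tendsto_cobounded_of_norm_eq hι)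
  have h2 := (tendsto_inv₀_cobounded.comp h1).pow l
  simpa [hl] using h2

theorem summable_div_add_pow (l : ℕ) (hl : l ≠ 0) (x w : L) :
    Summable fun d : F[X] => x / (w + ι d) ^ l := by
  simpa only [div_eq_mul_inv] using (summable_inv_add_pow hι l hl w).mul_left x

theorem tendsto_sum_inv_add_pow (l : ℕ) (hl : l ≠ 0) (w : L) :
    Tendsto (fun m => ∑ d ∈ polysDegreeLT F m, ((w + ι d) ^ l)⁻¹) atTop
      (𝓝 (latticeSum ι l w)) :=
  (summable_inv_add_pow hι l hl w).hasSum.comp tendsto_polysDegreeLT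

/-- The finite identity on `V × degreeLT F m`, with `f(v, d) = φ v + ι d` and `g` depending on `v`
alone, passes to the limit in `m`. -/
theorem sum_pow_mul_latticeSum {V : Type*} [AddCommGroup V] [Module F V] [Fintype V]
    (φ g : V →ₗ[F] L) (hφ : ∀ v d, φ v + ι d = 0 → v = 0) (l : ℕ) (hl : 1 ≤ l)
    (hlq : l ≤ Nat.card F) :
    ∑ v, g v ^ l * latticeSum ι l (φ v) = -(-∑ v, g v * latticeSum ι 1 (φ v)) ^ l := by
  classical
  have hι0 : ∀ d, ι d = 0 → d = 0 := by
    intro d hd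
    by_contra hd0
    have h := hι d hd0
    rw [hd, norm_zero] at h
    have hq : (Nat.card F : ℝ) ≠ 0 := by exact_mod_cast Nat.card_pos.ne'
    exact pow_ne_zero _ hq h.symm
  have hlim : ∀ k : ℕ, 1 ≤ k → Tendsto
      (fun m => ∑ v, g v ^ k * ∑ d ∈ polysDegreeLT F m, ((φ v + ι d) ^ k)⁻¹) atTop
      (𝓝 (∑ v, g v ^ k * latticeSum ι k (φ v))) := fun k hk =>
    tendsto_finsetSum _ fun v _ =>
      (tendsto_sum_inv_add_pow hι k (by lia) (φ v)).const_mul _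
  have hfin : ∀ m : ℕ, ∑ v, g v ^ l * ∑ d ∈ polysDegreeLT F m, ((φ v + ι d) ^ l)⁻¹ =
      -(-∑ v, g v ^ 1 * ∑ d ∈ polysDegreeLT F m, ((φ v + ι d) ^ 1)⁻¹) ^ l := by
    intro m
    have := Fintype.ofFinite (degreeLT F m)
    let f : V × degreeLT F m →ₗ[F] L := φ.coprod (ι.toLinearMap ∘ₗ (degreeLT F m).subtype)
    have hf : Function.Injective f := by
      rw [← LinearMap.ker_eq_bot, LinearMap.ker_eq_bot']
      rintro ⟨v, d⟩ hvd
      have hvd' : φ v + ι d = 0 := hvd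
      obtain rfl := hφ v d hvd'
      rw [map_zero, zero_add] at hvd'
      exact Prod.ext rfl (Subtype.ext (hι0 _ hvd'))
    obtain ⟨γ, hγ⟩ := exists_sum_div_pow_eq f (g ∘ₗ LinearMap.fst F V (degreeLT F m)) hf
    have key : ∀ k : ℕ, 1 ≤ k → k ≤ Nat.card F →
        ∑ v, g v ^ k * ∑ d ∈ polysDegreeLT F m, ((φ v + ι d) ^ k)⁻¹ = -γ ^ k := by
      intro k hk hkq
      -- The term at the origin can be restored because `0 / 0 = 0`.
      rw [← hγ k hk hkq, Finset.sum_erase _ (by simp [show k ≠ 0 by lia]),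
        Fintype.sum_prod_type]
      refine Finset.sum_congr rfl fun v _ => ?_
      rw [sum_polysDegreeLT, Finset.mul_sum]
      refine Finset.sum_congr rfl fun d _ => ?_
      simp [f, div_eq_mul_inv, mul_pow]
    rw [key l hl hlq, key 1 le_rfl (hl.trans hlq), pow_one, neg_neg]
  have h1 := hlim 1 le_rfl
  simp only [pow_one] at h1 hfin
  exact tendsto_nhds_unique (hlim l hl) (((h1.neg.pow l).neg).congr fun m => (hfin m).symm)

/-- The case `V = F`, `φ a = a • w`, `g a = a`: each of the `q - 1` nonzero scalars contributes the
same term. This carries decay from order one to order `l`. -/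
theorem latticeSum_eq_pow (w : L) (hw : ∀ d, w + ι d ≠ 0) (l : ℕ) (hl : 1 ≤ l)
    (hlq : l ≤ Nat.card F) : latticeSum ι l w = latticeSum ι 1 w ^ l := by
  classical
  have := Fintype.ofFinite F
  have hφ : ∀ (a : F) (d : F[X]), LinearMap.toSpanSingleton F L w a + ι d = 0 → a = 0 := by
    intro a d h
    by_contra ha
    refine hw (a⁻¹ • d) ?_
    rw [map_smul, ← smul_right_injective L ha |>.eq_iff]
    simpa [smul_smul, ha] using h
  have hsum : ∀ k : ℕ, 1 ≤ k → ∑ a : F, Algebra.linearMap F L a ^ k *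
      latticeSum ι k (LinearMap.toSpanSingleton F L w a) = -latticeSum ι k w := by
    intro k hk
    rw [← Finset.sum_erase (a := 0) _ (by simp [show k ≠ 0 by lia])]
    refine (Finset.sum_congr rfl fun a ha =>
      pow_mul_latticeSum_smul ι k a (Finset.ne_of_mem_erase ha) w).trans ?_
    rw [Finset.sum_const, Finset.card_erase_of_mem (Finset.mem_univ _), Finset.card_univ,
      ← Fintype.card_units, nsmul_eq_mul, natCast_card_units_eq_neg_one F L, neg_one_mul]
  have h := sum_pow_mul_latticeSum hι (LinearMap.toSpanSingleton F L w) (Algebra.linearMap F L)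
    hφ l hl hlq
  have h1 := hsum 1 le_rfl
  simp only [pow_one] at h1
  rw [hsum l hl, h1, neg_neg] at h
  exact neg_injective h

end LatticeSums

/-! ### Decay of the lattice sums and the sum over monic polynomials. -/

section OuterSum

open Polynomial Filter Topology

theorem tendsto_pow_mul_inv_pow_two_pow (r ρ : ℝ) (hr : 1 ≤ r) (hρ : 1 < ρ) :
    Tendsto (fun n : ℕ => r ^ n * ρ⁻¹ ^ 2 ^ n) atTop (𝓝 0) := by
  obtain ⟨k, hk⟩ := pow_unbounded_of_one_lt (2 * r) hρ
  have hρ0 : 0 < ρ := one_pos.trans hρ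
  have hlim : Tendsto (fun n : ℕ => (1 / 2 : ℝ) ^ n) atTop (𝓝 0) :=
    tendsto_pow_atTop_nhds_zero_of_lt_one (by norm_num) (by norm_num)
  have hkn : ∀ᶠ n : ℕ in atTop, k * n ≤ 2 ^ n := by
    have h := tendsto_pow_const_div_const_pow_of_one_lt 1 (one_lt_two (α := ℝ))
    have hpos : (0 : ℝ) < 1 / (k + 1) := by positivity
    filter_upwards [h.eventually (gt_mem_nhds hpos)] with n hn
    rw [pow_one, div_lt_div_iff₀ (by positivity) (by positivity)] at hn
    have : (k * n : ℝ) ≤ 2 ^ n := by nlinarith [Nat.cast_nonneg (α := ℝ) n]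
    exact_mod_cast this
  refine squeeze_zero' (Eventually.of_forall fun n => by positivity) ?_ hlim
  filter_upwards [hkn] with n hn
  calc r ^ n * ρ⁻¹ ^ 2 ^ n ≤ r ^ n * ρ⁻¹ ^ (k * n) := by
        gcongr r ^ n * ?_
        exact pow_le_pow_of_le_one (by positivity) (inv_le_one_of_one_le₀ hρ.le) hn
    _ = (r * (ρ ^ k)⁻¹) ^ n := by rw [pow_mul, inv_pow, mul_pow]
    _ ≤ (1 / 2) ^ n := by
        gcongr
        rw [mul_inv_le_iff₀ (by positivity)]
        linarith

variable {F L : Type*} [Field F] [NormedField L] [Algebra F L] [IsUltrametricDist L]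
  {ι : F[X] →ₐ[F] L}

/-- Nonzero elements of `F` are roots of unity, so the coefficients have norm at most one. -/
theorem norm_aeval_le [Finite F] (t : L) (p : F[X]) :
    ‖aeval t p‖ ≤ max 1 ‖t‖ ^ p.natDegree := by
  have := Fintype.ofFinite F
  rw [aeval_eq_sum_range]
  refine IsUltrametricDist.norm_sum_le_of_forall_le_of_nonneg (by positivity) fun i hi => ?_
  have hc : ‖algebraMap F L (p.coeff i)‖ ≤ 1 := by
    by_cases h : p.coeff i = 0
    · simp [h]
    · refine (pow_le_one_iff_of_nonneg (norm_nonneg _)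
        (Nat.sub_pos_of_lt (Fintype.one_lt_card (α := F))).ne').mp ?_
      rw [← norm_pow, ← map_pow, FiniteField.pow_card_sub_one_eq_one _ h, map_one, norm_one]
  rw [Algebra.smul_def, norm_mul, norm_pow]
  calc ‖algebraMap F L (p.coeff i)‖ * ‖t‖ ^ i ≤ 1 * max 1 ‖t‖ ^ i := by
        gcongr
        exact le_max_right _ _
    _ ≤ max 1 ‖t‖ ^ p.natDegree := by
        rw [one_mul]
        exact pow_le_pow_right₀ (le_max_left _ _) (Nat.lt_succ_iff.mp (Finset.mem_range.mp hi))

variable [Finite F] (hι : ∀ a : F[X], a ≠ 0 → ‖ι a‖ = (Nat.card F : ℝ) ^ a.natDegree)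
include hι

/-- A translate of `z` by a polynomial at minimal distance from the polynomials. -/
theorem exists_translate_norm_le (z : L) {δ : ℝ} (hδ : 1 < δ)
    (hz : ∀ a b, b ≠ 0 → δ ≤ ‖z - ι a / ι b‖) :
    ∃ (a : F[X]) (ρ : ℝ), 1 < ρ ∧ ∀ c, c ≠ 0 → ∀ d,
      ρ * ‖ι c‖ ≤ ‖ι c * (z - ι a) - ι d‖ ∧ ‖ι d‖ ≤ ‖ι c * (z - ι a) - ι d‖ := by
  have hq : (1 : ℝ) < Nat.card F := by exact_mod_cast Finite.one_lt_card (α := F)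
  obtain ⟨a, ha⟩ : ∃ a, ∀ b, ‖z - ι a‖ ≤ ‖z - ι b‖ := by
    have h : Tendsto (fun a => ‖z - ι a‖) cofinite atTop :=
      (tendsto_norm_cobounded_atTop.comp (tendsto_const_sub_cobounded z)).comp
        (tendsto_cobounded_of_norm_eq hι)
    exact h.exists_forall_le
  have ha1 : ∀ b, δ ≤ ‖z - ι b‖ := fun b => by simpa using hz b 1 one_ne_zero
  refine ⟨a, ‖z - ι a‖, hδ.trans_le (ha1 a), fun c hc d => ?_⟩
  have hc0 : ‖ι c‖ = (Nat.card F : ℝ) ^ c.natDegree := hι c hc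
  have hcpos : 0 < ‖ι c‖ := by rw [hc0]; positivity
  have hmain : ‖z - ι a‖ * ‖ι c‖ ≤ ‖ι c * (z - ι a) - ι d‖ := by
    -- Division by `c` moves the quotient into the translate of `z`; the remainder is too small to
    -- affect the norm.
    have hdiv : ι c * (z - ι a) - ι d = ι c * (z - ι (a + d / c)) - ι (d % c) := by
      conv_lhs => rw [← EuclideanDomain.div_add_mod d c]
      simp only [map_add, map_mul]
      ring
    have hmod : ‖ι (d % c)‖ < ‖ι c * (z - ι (a + d / c))‖ := by
      have h1 : ‖ι (d % c)‖ ≤ ‖ι c‖ := by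
        by_cases h0 : d % c = 0
        · simp [h0]
        · rw [hι _ h0, hc0]
          exact pow_le_pow_right₀ hq.le (natDegree_le_natDegree (degree_mod_lt d hc).le)
      refine h1.trans_lt ?_
      rw [norm_mul]
      exact lt_mul_of_one_lt_right hcpos (hδ.trans_le (ha1 _))
    rw [hdiv, sub_eq_add_neg (ι c * _), IsUltrametricDist.norm_add_eq_max_of_norm_ne_norm
      (by rw [norm_neg]; exact hmod.ne'), norm_neg, max_eq_left hmod.le, norm_mul, mul_comm]
    gcongr
    exact ha _
  refine ⟨hmain, ?_⟩
  rcases le_or_gt ‖ι d‖ ‖ι c * (z - ι a)‖ with h | h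
  · refine h.trans ?_
    rwa [norm_mul, mul_comm]
  · rw [sub_eq_add_neg, IsUltrametricDist.norm_add_eq_max_of_norm_ne_norm
      (by rw [norm_neg]; exact h.ne), norm_neg, max_eq_right h.le]

/-- By `sum_inv_sub_eq_div` a partial sum is `w⁻¹ ∏_{d ≠ 0} d / (w - d)`. No factor exceeds one in
norm, and those with `deg d ≤ n` are at most `ρ⁻¹`. -/
theorem norm_latticeSum_le [CompleteSpace L] (w : L) (n : ℕ) {ρ : ℝ} (hρ : 1 < ρ)
    (h1 : ∀ d, ρ * (Nat.card F : ℝ) ^ n ≤ ‖w - ι d‖) (h2 : ∀ d, ‖ι d‖ ≤ ‖w - ι d‖) :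
    ‖latticeSum ι 1 w‖ ≤ ρ⁻¹ ^ 2 ^ n := by
  classical
  have hq : (1 : ℝ) < Nat.card F := by exact_mod_cast Finite.one_lt_card (α := F)
  have hqn : (1 : ℝ) ≤ (Nat.card F : ℝ) ^ n := one_le_pow₀ hq.le
  have hρ0 : 0 < ρ := one_pos.trans hρ
  have hpos : ∀ d, 0 < ‖w - ι d‖ := fun d => lt_of_lt_of_le (by positivity) (h1 d)
  refine le_of_tendsto (tendsto_sum_inv_add_pow hι 1 one_ne_zero w).norm ?_
  filter_upwards [eventually_ge_atTop (n + 1)] with m hm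
  have := Fintype.ofFinite (degreeLT F m)
  let f : degreeLT F m →+ L := (ι.toLinearMap ∘ₗ (degreeLT F m).subtype).toAddMonoidHom
  have hf : Function.Injective f := by
    refine (injective_iff_map_eq_zero f).mpr fun d hd => ?_
    by_contra hd0
    have h := hι d (fun h => hd0 (Subtype.ext h))
    change ι d = 0 at hd
    rw [hd, norm_zero] at h
    have : (0 : ℝ) < (Nat.card F : ℝ) ^ (d : F[X]).natDegree := by positivity
    exact this.ne h
  have hsum : ∑ d ∈ polysDegreeLT F m, ((w + ι d) ^ 1)⁻¹ = ∑ d, (w - f d)⁻¹ := by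
    rw [sum_polysDegreeLT, ← Fintype.sum_equiv (Equiv.neg (degreeLT F m)) _ _ fun _ => rfl]
    simp [f, sub_eq_add_neg]
  rw [hsum, sum_inv_sub_eq_div f hf w fun d h => (hpos d).ne' (by rw [h]; simp [f]),
    ← Finset.mul_prod_erase _ (fun d => w - f d) (Finset.mem_univ 0), mul_comm (w - f 0),
    ← div_div, ← Finset.prod_div_distrib, norm_div, norm_prod]
  have hw : 1 ≤ ‖w - f 0‖ := by
    refine le_trans ?_ (h1 0)
    exact (one_le_mul_of_one_le_of_one_le hρ.le hqn)
  refine (div_le_self (Finset.prod_nonneg fun _ _ => norm_nonneg _) hw).trans ?_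
  let T : Finset (degreeLT F m) :=
    (Finset.univ.erase 0).filter fun d => (d : F[X]).degree < (n + 1 : ℕ)
  have hle : ∀ d ∈ Finset.univ.erase (0 : degreeLT F m),
      ‖f d / (w - f d)‖ ≤ if d ∈ T then ρ⁻¹ else 1 := by
    intro d hd
    change ‖ι d / (w - ι d)‖ ≤ _
    rw [norm_div]
    split_ifs with hT
    · have hd0 : (d : F[X]) ≠ 0 := fun h => Finset.ne_of_mem_erase hd (Subtype.ext h)
      have hdeg : (d : F[X]).natDegree ≤ n :=
        Nat.lt_succ_iff.mp ((natDegree_lt_iff_degree_lt hd0).mpr (Finset.mem_filter.mp hT).2)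
      rw [div_le_iff₀ (hpos d), hι d hd0]
      calc (Nat.card F : ℝ) ^ (d : F[X]).natDegree ≤ (Nat.card F : ℝ) ^ n :=
            pow_le_pow_right₀ hq.le hdeg
        _ = ρ⁻¹ * (ρ * (Nat.card F : ℝ) ^ n) := by field_simp
        _ ≤ ρ⁻¹ * ‖w - ι d‖ := by gcongr; exact h1 d
    · exact div_le_one_of_le₀ (h2 d) (norm_nonneg _)
  have hcard : 2 ^ n ≤ T.card := by
    have hT : T.map (Function.Embedding.subtype _) = (polysDegreeLT F (n + 1)).erase 0 := by
      ext p
      simp only [T, Finset.mem_map, Finset.mem_filter, Finset.mem_erase, Finset.mem_univ, and_true,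
        Function.Embedding.subtype_apply, mem_polysDegreeLT]
      constructor
      · rintro ⟨d, ⟨hd0, hd⟩, rfl⟩
        exact ⟨fun h => hd0 (Subtype.ext h), hd⟩
      · rintro ⟨hp0, hp⟩
        exact ⟨⟨p, mem_degreeLT.mpr (hp.trans_le (by exact_mod_cast hm))⟩,
          ⟨fun h => hp0 (congrArg Subtype.val h), hp⟩, rfl⟩
    have hc := congrArg Finset.card hT
    rw [Finset.card_map, Finset.card_erase_of_mem (mem_polysDegreeLT.mpr (by simp)),
      card_polysDegreeLT] at hc
    -- There are `q^(n+1) - 1` such factors; `2^n` is a crude lower bound that suffices.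
    have hq2 : 2 ^ (n + 1) ≤ Nat.card F ^ (n + 1) :=
      Nat.pow_le_pow_left (Finite.one_lt_card (α := F)) _
    have := Nat.one_le_two_pow (n := n)
    rw [pow_succ] at hq2
    lia
  calc ∏ d ∈ Finset.univ.erase (0 : degreeLT F m), ‖f d / (w - f d)‖
      ≤ ∏ d ∈ Finset.univ.erase (0 : degreeLT F m), (if d ∈ T then ρ⁻¹ else 1) :=
        Finset.prod_le_prod (fun _ _ => norm_nonneg _) hle
    _ = ρ⁻¹ ^ T.card := by
        rw [← Finset.prod_filter, Finset.prod_const]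
        congr 2
        ext d
        simp [T]
    _ ≤ ρ⁻¹ ^ 2 ^ n :=
        pow_le_pow_of_le_one (by positivity) (inv_le_one_of_one_le₀ hρ.le) hcard

omit [IsUltrametricDist L] hι [Finite F] in
theorem latticeSum_sub (w : L) (a : F[X]) (l : ℕ) :
    latticeSum ι l (w - ι a) = latticeSum ι l w := by
  rw [latticeSum, ← (Equiv.addRight a).tsum_eq, latticeSum]
  simp

variable [CompleteSpace L] (z : L) {δ : ℝ} (hδ : 1 < δ)
  (hz : ∀ a b, b ≠ 0 → δ ≤ ‖z - ι a / ι b‖)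
include hδ hz

omit [IsUltrametricDist L] [CompleteSpace L] in
theorem mul_add_ne_zero {c : F[X]} (hc : c ≠ 0) (d : F[X]) : ι c * z + ι d ≠ 0 := by
  intro h
  have hc0 : ι c ≠ 0 := by
    rw [← norm_ne_zero_iff, hι c hc]
    exact pow_ne_zero _ (by exact_mod_cast Nat.card_pos.ne')
  have h1 := hz (-d) c hc
  have h2 : z - ι (-d) / ι c = 0 := by
    rw [map_neg]
    field_simp
    linear_combination h
  rw [h2, norm_zero] at h1
  linarith

theorem tendsto_aeval_mul_latticeSum (t : L) :
    Tendsto (fun c : {c : F[X] // c.Monic} => aeval t c.1 * latticeSum ι 1 (ι c.1 * z))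
      cofinite (𝓝 0) := by
  obtain ⟨a, ρ, hρ, h⟩ := exists_translate_norm_le hι z hδ hz
  have hlim := (tendsto_pow_mul_inv_pow_two_pow (max 1 ‖t‖) ρ (le_max_left _ _) hρ).comp
    (tendsto_natDegree_cofinite.comp
      (Subtype.val_injective (p := (Monic : F[X] → Prop))).tendsto_cofinite)
  refine squeeze_zero_norm (fun c => ?_) hlim
  have hc := c.2.ne_zero
  rw [norm_mul]
  refine mul_le_mul (norm_aeval_le t c.1) ?_ (norm_nonneg _) (by positivity)
  -- Translating by the lattice element `c a` replaces `z` by the optimal `z - a`.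
  rw [← latticeSum_sub _ (c.1 * a), map_mul, ← mul_sub]
  refine norm_latticeSum_le hι _ _ hρ (fun d => ?_) fun d => (h c.1 hc d).2
  rw [Function.comp_apply, ← hι c.1 hc]
  exact (h c.1 hc d).1

theorem sum_monic_pow_eq_pow_sum (χ : F[X] →ₐ[F] L) (n : ℕ)
    [DecidablePred (Monic : F[X] → Prop)] (l : ℕ) (hl : 1 ≤ l) (hlq : l ≤ Nat.card F) :
    ∑ c ∈ (polysDegreeLT F n).filter Monic, χ c ^ l * latticeSum ι l (ι c * z) =
      (∑ c ∈ (polysDegreeLT F n).filter Monic, χ c * latticeSum ι 1 (ι c * z)) ^ l := by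
  have := Fintype.ofFinite (degreeLT F n)
  let φ : degreeLT F n →ₗ[F] L :=
    (LinearMap.mulRight F z ∘ₗ ι.toLinearMap) ∘ₗ (degreeLT F n).subtype
  have h := sum_pow_mul_latticeSum hι φ (χ.toLinearMap ∘ₗ (degreeLT F n).subtype)
    (fun v d hvd => by
      by_contra hv
      exact mul_add_ne_zero hι z hδ hz (fun h => hv (Subtype.ext h)) d hvd) l hl hlq
  have hmonic : ∀ k : ℕ, 1 ≤ k → ∑ v : degreeLT F n,
      (χ.toLinearMap ∘ₗ (degreeLT F n).subtype) v ^ k * latticeSum ι k (φ v) =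
      -∑ c ∈ (polysDegreeLT F n).filter Monic, χ c ^ k * latticeSum ι k (ι c * z) := by
    intro k hk
    rw [← sum_polysDegreeLT_eq_neg_sum_monic n
      (fun c => χ c ^ k * latticeSum ι k (ι c * z)), sum_polysDegreeLT]
    · rfl
    · simp [show k ≠ 0 by lia]
    · intro b p hb
      simp only [map_smul, smul_mul_assoc]
      rw [Algebra.smul_def, mul_pow, mul_right_comm, pow_mul_latticeSum_smul ι k b hb, mul_comm]
  have h1 := hmonic 1 le_rfl
  simp only [pow_one] at h1
  rw [hmonic l hl, h1, neg_neg] at h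
  exact neg_injective h

theorem summable_and_tsum_eq_pow (t : L) (l : ℕ) (hl : 1 ≤ l) (hlq : l ≤ Nat.card F) :
    (Summable fun c : {c : F[X] // c.Monic} =>
      aeval t c.1 ^ l * latticeSum ι l (ι c.1 * z)) ∧
    ∑' c : {c : F[X] // c.Monic}, aeval t c.1 ^ l * latticeSum ι l (ι c.1 * z) =
      (∑' c : {c : F[X] // c.Monic}, aeval t c.1 * latticeSum ι 1 (ι c.1 * z)) ^ l := by
  classical
  have hsum : ∀ k : ℕ, 1 ≤ k → k ≤ Nat.card F →
      Summable fun c : {c : F[X] // c.Monic} => aeval t c.1 ^ k * latticeSum ι k (ι c.1 * z) := by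
    intro k hk hkq
    refine NonarchimedeanAddGroup.summable_of_tendsto_cofinite_zero ?_
    have h := (tendsto_aeval_mul_latticeSum hι z hδ hz t).pow k
    rw [zero_pow (by lia)] at h
    refine h.congr fun c => ?_
    rw [mul_pow, ← latticeSum_eq_pow hι _ (mul_add_ne_zero hι z hδ hz c.2.ne_zero) k hk hkq]
  have hlim : ∀ k : ℕ, 1 ≤ k → k ≤ Nat.card F → Tendsto (fun n =>
      ∑ c ∈ (polysDegreeLT F n).filter Monic, aeval t c ^ k * latticeSum ι k (ι c * z)) atTop
      (𝓝 (∑' c : {c : F[X] // c.Monic}, aeval t c.1 ^ k * latticeSum ι k (ι c.1 * z))) := by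
    intro k hk hkq
    have hT : Tendsto (fun n => (polysDegreeLT F n).subtype Monic) atTop atTop :=
      tendsto_atTop_finset_of_monotone
        (fun m n h => Finset.subtype_mono (polysDegreeLT_mono h))
        fun c => ((tendsto_polysDegreeLT.eventually_ge_atTop {c.1}).exists).imp fun n hn => by
          simpa using hn
    refine ((hsum k hk hkq).hasSum.comp hT).congr fun n => ?_
    exact Finset.sum_subtype_eq_sum_filter (p := Monic)
      (fun c => aeval t c ^ k * latticeSum ι k (ι c * z))
  have h1 := hlim 1 le_rfl (hl.trans hlq)
  simp only [pow_one] at h1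
  refine ⟨hsum l hl hlq, tendsto_nhds_unique (hlim l hl hlq) ((h1.pow l).congr fun n => ?_)⟩
  exact (sum_monic_pow_eq_pow_sum hι z hδ hz (aeval t) n l hl hlq).symm

end OuterSum

/-! ### Specialization to `ℂ_∞`. -/

instance isUltrametricDist_KinftyBar (F : Type*) [Field F] [Finite F] :
    IsUltrametricDist (KinftyBar F) :=
  IsUltrametricDist.isUltrametricDist_of_forall_norm_add_le_max_norm
    (isNonarchimedean_spectralNorm (K := Kinfty F) (L := KinftyBar F))

instance isUltrametricDist_Cinfty (F : Type*) [Field F] [Finite F] :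
    IsUltrametricDist (Cinfty F) := by
  refine IsUltrametricDist.isUltrametricDist_of_forall_norm_add_le_max_norm fun x y => ?_
  induction x, y using UniformSpace.Completion.induction_on₂ with
  | hp => exact isClosed_le (by fun_prop) (by fun_prop)
  | ih a b =>
    rw [← UniformSpace.Completion.coe_add, UniformSpace.Completion.norm_coe,
      UniformSpace.Completion.norm_coe, UniformSpace.Completion.norm_coe]
    exact IsUltrametricDist.norm_add_le_max a b

theorem imDist_le_norm_sub_div {F : Type*} [Field F] [Finite F] (z : Cinfty F) (a b : F[X]) :
    imDist z ≤ ‖z - embA F a / embA F b‖ := by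
  refine (ciInf_le ⟨0, ?_⟩ (ratEmb F (algebraMap F[X] (RatFunc F) a) /
    ratEmb F (algebraMap F[X] (RatFunc F) b))).trans_eq ?_
  · rintro _ ⟨x, rfl⟩
    exact norm_nonneg _
  · rw [map_div₀]
    rfl

theorem corollary4p3 {F : Type*} [Field F] [Finite F] (l : ℕ) (hl : 1 ≤ l)
    (hlq : l ≤ Nat.card F) (z t : Cinfty F) (hz : z ∈ Omega1 F)
    (ht : t ∈ Metric.ball (0 : Cinfty F) ((Nat.card F : ℝ) ^ Nat.card F)) :
    ((∀ c : APlus F, Summable fun d : F[X] =>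
        chi t c.1 ^ l / (embA F c.1 * z + embA F d) ^ l) ∧
      Summable fun c : APlus F =>
        ∑' d : F[X], chi t c.1 ^ l / (embA F c.1 * z + embA F d) ^ l) ∧
    ((∀ c : APlus F, Summable fun d : F[X] =>
        chi t c.1 / (embA F c.1 * z + embA F d)) ∧
      Summable fun c : APlus F =>
        ∑' d : F[X], chi t c.1 / (embA F c.1 * z + embA F d)) ∧
    ∑' (c : APlus F) (d : F[X]), chi t c.1 ^ l / (embA F c.1 * z + embA F d) ^ l =
      (∑' (c : APlus F) (d : F[X]), chi t c.1 / (embA F c.1 * z + embA F d)) ^ l := by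
  -- With constants acting through `embA`, `chi t` is definitionally `Polynomial.aeval t`.
  let : Algebra F (Cinfty F) := ((embA F).comp Polynomial.C).toAlgebra
  let ι : F[X] →ₐ[F] Cinfty F := { embA F with commutes' := fun _ => rfl }
  have hι : ∀ a : F[X], a ≠ 0 → ‖ι a‖ = (Nat.card F : ℝ) ^ a.natDegree :=
    fun a ha => norm_embA F ha
  have hι' : ∀ a, embA F a = ι a := fun _ => rfl
  have hχ : ∀ c, chi t c = Polynomial.aeval t c := fun _ => rfl
  -- Fractions `a / b` lie in `K_∞`, so `imDist z > 1` serves as the uniform gap `δ`.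
  have hzι : ∀ a b : F[X], b ≠ 0 → imDist z ≤ ‖z - ι a / ι b‖ :=
    fun a b _ => imDist_le_norm_sub_div z a b
  have h1 : ∀ x w : Cinfty F, ∑' d : F[X], x / (w + ι d) = x * latticeSum ι 1 w := by
    intro x w
    simpa only [pow_one] using tsum_div_eq_mul_latticeSum ι 1 x w
  have hone := (summable_and_tsum_eq_pow hι z hz.2 hzι t 1 le_rfl (hl.trans hlq)).1
  obtain ⟨hsum, heq⟩ := summable_and_tsum_eq_pow hι z hz.2 hzι t l hl hlq
  simp only [pow_one] at hone
  simp only [hι', hχ, tsum_div_eq_mul_latticeSum, h1]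
  refine ⟨⟨fun c => summable_div_add_pow hι l (by lia) _ _, hsum⟩, ⟨fun c => ?_, hone⟩, heq⟩
  simpa only [pow_one] using summable_div_add_pow hι 1 one_ne_zero (Polynomial.aeval t c.1) _
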